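/- Let $n\ge 0$ and $m\ge 1$ be integers. For $i=1,\dots,m$ let $A_i\in\mathbb{R}^{n\times n}$ be symmetric, $b_i\in\mathbb{R}^n$, $\beta_i\in\mathbb{R}$, and let $r_i:\mathbb{R}^n\to(-\infty,+\infty]$ be a proper closed (i.e. lower semicontinuous, not identically $+\infty$) polyhedral function, meaning that its epigraph $\{(x,\alpha)\in\mathbb{R}^n\times\mathbb{R}: r_i(x)\le\alpha\}$ is an intersection of finitely many closed half-spaces. Put $$u(x)=\min_{1\le i\le m}\Big\{\tfrac12 x^\top A_i x+b_i^\top x+\beta_i+r_i(x)\Big\},\qquad x\in\mathbb{R}^n.$$ For a function $f:\mathbb{R}^n\to(-\infty,+\infty]$ let $\partial f$ denote its limiting subdifferential: for $f(x)$ finite, $v\in\partial f(x)$ if and only if there are $x_k\to x$ with $f(x_k)\to f(x)$ and $v_k\to v$ such that, for every $k$, $f(x_k)$ is finite and $f(y)\ge f(x_k)+\langle v_k,y-x_k\rangle+o(\|y-x_k\|)$ as $y\to x_k$; and $\partial f(x)=\emptyset$ if $f(x)=+\infty$. Let $\mathrm{dom}\,\partial f=\{x:\partial f(x)\neq\emptyset\}$.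 Suppose that (the restriction of) $u$ is continuous on $\mathrm{dom}\,\partial u$. Then $u$ is a KL function with exponent $\tfrac12$ in the following two-sided sense: $u$ is proper and closed, and for every $\bar x\in\mathrm{dom}\,\partial u$ there exist a neighborhood $E$ of $\bar x$ and $\kappa,\eta\in(0,\infty)$ such that $$\|g\|\ \ge\ \kappa\,|u(x)-u(\bar x)|^{1/2}$$ for all $x\in E$ with $u(\bar x)-\eta<u(x)<u(\bar x)+\eta$ and all $g\in\partial u(x)$, where $\|\cdot\|$ is the Euclidean norm. -/

import Mathlib

open Filter Topology

namespace KL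

/-- An extended-real-valued function is proper if it never takes the value `-∞` and
is not identically `+∞`. -/
def IsProper {X : Type*} (f : X → EReal) : Prop :=
  (∀ x, f x ≠ ⊥) ∧ ∃ x, f x ≠ ⊤

/-- A proper closed function: proper and lower semicontinuous. -/
def IsProperClosed {X : Type*} [TopologicalSpace X] (f : X → EReal) : Prop :=
  IsProper f ∧ LowerSemicontinuous f

/-- The epigraph `{(x, α) ∈ X × ℝ : f x ≤ α}`. -/
def epigraph {X : Type*} (f : X → EReal) : Set (X × ℝ) :=
  {p | f p.1 ≤ (p.2 : EReal)}

/-- A polyhedron: the intersection of finitely many closed half-spaces. -/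
def IsPolyhedron {V : Type*} [NormedAddCommGroup V] [NormedSpace ℝ V] (S : Set V) : Prop :=
  ∃ (k : ℕ) (φ : Fin k → (V →L[ℝ] ℝ)) (d : Fin k → ℝ), S = {p | ∀ j, φ j p ≤ d j}

/-- A polyhedral function: its epigraph is a polyhedron. -/
def IsPolyhedral {V : Type*} [NormedAddCommGroup V] [NormedSpace ℝ V] (f : V → EReal) : Prop :=
  IsPolyhedron (epigraph f)

section Subdifferential

variable {V : Type*} [NormedAddCommGroup V] [InnerProductSpace ℝ V]

/-- The regular (Fréchet) subdifferential at a point where `f` is finite: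
`v` with `f y ≥ f x + ⟪v, y - x⟫ + o(‖y - x‖)` as `y → x`. It is empty where `f` is infinite. -/
def regularSubdifferential (f : V → EReal) (x : V) : Set V :=
  {v | f x ≠ ⊥ ∧ f x ≠ ⊤ ∧ ∀ ε : ℝ, 0 < ε →
    ∀ᶠ y in 𝓝 x, f x + ((inner ℝ v (y - x) - ε * ‖y - x‖ : ℝ) : EReal) ≤ f y}

/-- The limiting subdifferential: limits of regular subgradients `v k` at points `x k → x`
with `f (x k) → f x`. It is empty where `f` is infinite. -/
def limitingSubdifferential (f : V → EReal) (x : V) : Set V :=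
  {v | f x ≠ ⊥ ∧ f x ≠ ⊤ ∧ ∃ (xs vs : ℕ → V),
    Tendsto xs atTop (𝓝 x) ∧ Tendsto (fun k => f (xs k)) atTop (𝓝 (f x)) ∧
    (∀ k, vs k ∈ regularSubdifferential f (xs k)) ∧ Tendsto vs atTop (𝓝 v)}

/-- The domain `dom ∂f` of the limiting subdifferential. -/
def domSubdifferential (f : V → EReal) : Set V :=
  {x | (limitingSubdifferential f x).Nonempty}

/-- The power `t ^ θ` for `t ≥ 0`, with the convention `0 ^ 0 = 0`. -/
noncomputable def klPow (t θ : ℝ) : ℝ := if t = 0 then 0 else t ^ θ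

/-- The two-sided Kurdyka-Łojasiewicz inequality for `f` at `z` (a point where `f` is finite)
with exponent `θ`. The values `f z` and `f x` that occur are finite, so that `toReal` is
the identity on them. -/
def HasKLProperty (f : V → EReal) (θ : ℝ) (z : V) : Prop :=
  f z ≠ ⊥ ∧ f z ≠ ⊤ ∧
  ∃ E ∈ 𝓝 z, ∃ κ η : ℝ, 0 < κ ∧ 0 < η ∧
    ∀ x ∈ E, f z - (η : EReal) < f x → f x < f z + (η : EReal) →
      ∀ g ∈ limitingSubdifferential f x,
        κ * klPow |(f x).toReal - (f z).toReal| θ ≤ ‖g‖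

/-- A KL function with exponent `θ ∈ [0, 1)` in the two-sided sense: a proper closed function
that has the two-sided KL property with exponent `θ` at every point of `dom ∂f`. -/
structure IsKLFunction (f : V → EReal) (θ : ℝ) : Prop where
  exponent_mem : θ ∈ Set.Ico (0 : ℝ) 1
  properClosed : IsProperClosed f
  hasKLProperty : ∀ z ∈ domSubdifferential f, HasKLProperty f θ z

end Subdifferential

end KL

/-! Near a fixed point, the change in value of a quadratic is at most a constant times the squared
norm of its gradient (`exists_quadratic_le_sq_gradient`): the gradient is either bounded away from
zero or a symmetric linear map of the displacement. Polyhedral terms reduce to this by lifting to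
the epigraph of `r`, where `q + r` becomes the quadratic `q y + α`. A regular subgradient of the
minimum `u` at `x` is one for any piece attaining it, so it controls the lifted gradient along the
face through `(x, r x)` (`liftedLinear_eq_of_mem_regularSubdifferential`). Finitely many faces and
pieces give a uniform constant, and the inequality survives limits of subgradients. -/

namespace KL

/-! ### Gradient bounds for quadratic functions -/

section Quadratic

variable {W : Type*} [NormedAddCommGroup W] [NormedSpace ℝ W] [FiniteDimensional ℝ W]

/-- Every vector in the range of a linear map on a finite-dimensional space has a preimage of
comparable norm. -/
theorem exists_preimage_norm_le_of_mem_range {F : Type*} [NormedAddCommGroup F] [NormedSpace ℝ F]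
    (T : W →L[ℝ] F) : ∃ C : NNReal, ∀ x, ∃ z, T z = T x ∧ ‖z‖ ≤ C * ‖T x‖ := by
  obtain ⟨s, hs⟩ := LinearMap.exists_rightInverse_of_surjective
    (T : W →ₗ[ℝ] F).rangeRestrict (LinearMap.range_rangeRestrict _)
  refine ⟨‖LinearMap.toContinuousLinearMap s‖₊, fun x =>
    ⟨s ((T : W →ₗ[ℝ] F).rangeRestrict x), ?_, ?_⟩⟩
  · exact congrArg Subtype.val (LinearMap.congr_fun hs ((T : W →ₗ[ℝ] F).rangeRestrict x))
  · exact (LinearMap.toContinuousLinearMap s).le_opNorm ((T : W →ₗ[ℝ] F).rangeRestrict x)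

/-- Near the origin, the value of a quadratic function without constant term is bounded by the
square of the norm of its derivative. -/
theorem exists_quadratic_le_sq_gradient (B : W →L[ℝ] W →L[ℝ] ℝ) (hB : ∀ x y, B x y = B y x)
    (l : W →L[ℝ] ℝ) :
    ∃ C : ℝ, ∀ᶠ h in 𝓝 (0 : W), ∀ G : ℝ, 0 ≤ G → (∀ w, |l w + B h w| ≤ G * ‖w‖) →
      |l h + 1 / 2 * B h h| ≤ C * G ^ 2 := by
  by_cases hl : l = 0
  · obtain ⟨C, hC⟩ := exists_preimage_norm_le_of_mem_range B
    refine ⟨C, Eventually.of_forall fun h G hG hw => ?_⟩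
    subst hl
    simp only [zero_apply, zero_add] at hw ⊢
    obtain ⟨z, hz, hzn⟩ := hC h
    have hG' : ‖B h‖ ≤ G := ContinuousLinearMap.opNorm_le_bound (B h) hG hw
    -- By symmetry `B h z = B z h = B h h`, so one factor `h` is replaced by a preimage of size
    -- `O(G)`.
    have h1 : B h h = B h z := by rw [hB h z, hz]
    have h2 : |B h z| ≤ G * (C * G) := (hw _).trans <| by
      gcongr
      exact hzn.trans (by gcongr)
    rw [h1, abs_mul, abs_of_pos (by norm_num : (0 : ℝ) < 1 / 2)]
    nlinarith [abs_nonneg (B h z)]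
  · obtain ⟨w, hw⟩ : ∃ w, l w ≠ 0 := by
      by_contra! hcon
      exact hl (ContinuousLinearMap.ext hcon)
    have hw0 : 0 < ‖w‖ := norm_pos_iff.2 fun h => hw (by simp [h])
    have hc : 0 < |l w| / 2 / ‖w‖ := by positivity
    -- Near `0` the slope along `w` is at least `|l w| / 2 / ‖w‖`, while the value stays below `1`.
    refine ⟨1 / (|l w| / 2 / ‖w‖) ^ 2, ?_⟩
    have e1 : ∀ᶠ h in 𝓝 (0 : W), |B h w| < |l w| / 2 := by
      have : Continuous fun h => |B h w| := by fun_prop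
      exact this.continuousAt.eventually_lt_const (by simpa using hw)
    have e2 : ∀ᶠ h in 𝓝 (0 : W), |l h + 1 / 2 * B h h| < 1 := by
      have : Continuous fun h => |l h + 1 / 2 * B h h| := by fun_prop
      exact this.continuousAt.eventually_lt_const (by simp)
    filter_upwards [e1, e2] with h h1 h2 G hG hgrad
    have h3 : |l w| / 2 / ‖w‖ ≤ G := by
      rw [div_le_iff₀ hw0]
      have := abs_sub_abs_le_abs_sub (l w) (-(B h w))
      rw [abs_neg, sub_neg_eq_add] at this
      linarith [hgrad w]
    refine h2.le.trans ?_
    rw [div_mul_eq_mul_div, one_mul, one_le_div (pow_pos hc 2)]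
    gcongr

/-- The relative version of `exists_quadratic_le_sq_gradient` on a subspace. -/
theorem exists_quadratic_le_sq_gradient_of_mem (B : W →L[ℝ] W →L[ℝ] ℝ)
    (hB : ∀ x y, B x y = B y x) (l : W →L[ℝ] ℝ) (V : Submodule ℝ W) :
    ∃ C : ℝ, ∀ᶠ h in 𝓝 (0 : W), h ∈ V → ∀ G : ℝ, 0 ≤ G →
      (∀ w ∈ V, |l w + B h w| ≤ G * ‖w‖) → |l h + 1 / 2 * B h h| ≤ C * G ^ 2 := by
  obtain ⟨C, hC⟩ := exists_quadratic_le_sq_gradient (B.bilinearComp V.subtypeL V.subtypeL)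
    (fun x y => hB x y) (l.comp V.subtypeL)
  refine ⟨C, ?_⟩
  rw [nhds_induced, eventually_comap] at hC
  filter_upwards [hC] with h hh hV G hG hw
  exact hh ⟨h, hV⟩ rfl G hG fun w => hw w w.2

end Quadratic

/-- If `t ↦ a t + b t²` is bounded below by `-ε c |t|` near `0` for every `ε > 0`, then `a = 0`. -/
theorem linear_coeff_eq_zero {a b c : ℝ} (hc : 0 ≤ c)
    (h : ∀ ε : ℝ, 0 < ε → ∀ᶠ t in 𝓝 (0 : ℝ), -(ε * (|t| * c)) ≤ a * t + b * t ^ 2) : a = 0 := by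
  by_contra ha
  have ha' : 0 < |a| := abs_pos.2 ha
  -- The error and the quadratic term each cost at most `|a| / 4 * |t|`, too little to offset `-|a|
  -- * |t|`; `c + 1` covers `c = 0`.
  have h1 := h (|a| / 4 / (c + 1)) (by positivity)
  have h2 : ∀ᶠ t in 𝓝 (0 : ℝ), |b| * |t| < |a| / 4 := by
    have : Continuous fun t : ℝ => |b| * |t| := by fun_prop
    exact this.continuousAt.eventually_lt_const (by simpa using ha)
  obtain ⟨δ, hδ, hball⟩ := Metric.eventually_nhds_iff.1 (h1.and h2)
  have key : ∀ s : ℝ, |s| = δ / 2 → a * s = -(|a| * (δ / 2)) → False := by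
    intro s hs has
    obtain ⟨h3, h4⟩ := hball (y := s) (by rw [Real.dist_eq, sub_zero, hs]; linarith)
    have h5 : |a| / 4 / (c + 1) * c ≤ |a| / 4 := by
      rw [div_mul_eq_mul_div, div_le_iff₀ (by positivity)]
      nlinarith
    have h6 : b * s ^ 2 ≤ |b| * |s| * |s| := by
      rw [← sq_abs s, mul_assoc, ← sq]
      exact mul_le_mul_of_nonneg_right (le_abs_self b) (sq_nonneg _)
    rw [hs] at h3 h4 h6
    nlinarith
  rcases le_total 0 a with h0 | h0
  · exact key (-(δ / 2)) (by rw [abs_neg, abs_of_pos (by positivity)])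
      (by rw [abs_of_nonneg h0]; ring)
  · exact key (δ / 2) (abs_of_pos (by positivity)) (by rw [abs_of_nonpos h0]; ring)

/-- A bound `d ≤ C ‖g‖²` in the form of a Kurdyka-Łojasiewicz inequality of exponent `1/2`. -/
theorem klPow_half_le_of_le_sq {C d t : ℝ} (hC : 0 < C) (ht : 0 ≤ t) (h : d ≤ C * t ^ 2) :
    (√C)⁻¹ * klPow d (1 / 2) ≤ t := by
  unfold klPow
  split_ifs
  · simpa using ht
  · rw [← Real.sqrt_eq_rpow, inv_mul_le_iff₀ (Real.sqrt_pos.2 hC)]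
    calc √d ≤ √(C * t ^ 2) := Real.sqrt_le_sqrt h
      _ = √C * t := by rw [Real.sqrt_mul hC.le, Real.sqrt_sq ht]

/-! ### Lifting to the epigraph and its faces -/

section QuadraticPolyhedral

variable {V : Type*} [NormedAddCommGroup V] [InnerProductSpace ℝ V]

/-- The quadratic function `½⟪x, a x⟫ + ⟪b, x⟫ + β`. -/
noncomputable def quadratic (a : V →L[ℝ] V) (b : V) (β : ℝ) (x : V) : ℝ :=
  1 / 2 * inner ℝ x (a x) + inner ℝ b x + β

theorem continuous_quadratic (a : V →L[ℝ] V) (b : V) (β : ℝ) : Continuous (quadratic a b β) := by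
  unfold quadratic
  fun_prop

theorem quadratic_add {a : V →L[ℝ] V} (ha : ∀ x y, inner ℝ (a x) y = inner ℝ (a y) x)
    (b : V) (β : ℝ) (x h : V) :
    quadratic a b β (x + h) =
      quadratic a b β x + inner ℝ (a x + b) h + 1 / 2 * inner ℝ (a h) h := by
  have h1 := ha x h
  rw [real_inner_comm x] at h1
  simp only [quadratic, map_add, inner_add_left, inner_add_right, h1]
  rw [real_inner_comm (a x) h, real_inner_comm (a h) h, ha x h, real_inner_comm (a h) x]
  ring

/-- The bilinear form `(x, α), (y, γ) ↦ ⟪a x, y⟫` on the space of an epigraph. -/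
noncomputable def liftedHessian (a : V →L[ℝ] V) : (V × ℝ) →L[ℝ] (V × ℝ) →L[ℝ] ℝ :=
  ((innerSL ℝ : V →L[ℝ] V →L[ℝ] ℝ).comp a).bilinearComp
    (ContinuousLinearMap.fst ℝ V ℝ) (ContinuousLinearMap.fst ℝ V ℝ)

theorem liftedHessian_apply (a : V →L[ℝ] V) (p w : V × ℝ) :
    liftedHessian a p w = inner ℝ (a p.1) w.1 := rfl

/-- The linear form `(x, α) ↦ ⟪c, x⟫ + α` on the space of an epigraph. -/
noncomputable def liftedLinear (c : V) : (V × ℝ) →L[ℝ] ℝ :=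
  (innerSL ℝ c).comp (ContinuousLinearMap.fst ℝ V ℝ) + ContinuousLinearMap.snd ℝ V ℝ

theorem liftedLinear_apply (c : V) (w : V × ℝ) : liftedLinear c w = inner ℝ c w.1 + w.2 := rfl

/-- The directions orthogonal to the constraints in `J`. -/
def faceDirection {W : Type*} [NormedAddCommGroup W] [NormedSpace ℝ W] {k : ℕ}
    (φ : Fin k → W →L[ℝ] ℝ) (J : Set (Fin k)) : Submodule ℝ W :=
  ⨅ j ∈ J, LinearMap.ker (φ j : W →ₗ[ℝ] ℝ)

theorem mem_faceDirection {W : Type*} [NormedAddCommGroup W] [NormedSpace ℝ W] {k : ℕ}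
    {φ : Fin k → W →L[ℝ] ℝ} {J : Set (Fin k)} {w : W} :
    w ∈ faceDirection φ J ↔ ∀ j ∈ J, φ j w = 0 := by
  simp [faceDirection]

/-- A polyhedron contains a neighborhood of each of its points in the corresponding face. -/
theorem eventually_add_smul_mem_polyhedron {W : Type*} [NormedAddCommGroup W] [NormedSpace ℝ W]
    {k : ℕ} {φ : Fin k → W →L[ℝ] ℝ} {d : Fin k → ℝ} {p w : W} (hp : ∀ j, φ j p ≤ d j)
    (hw : w ∈ faceDirection φ {j | φ j p = d j}) :
    ∀ᶠ t in 𝓝 (0 : ℝ), ∀ j, φ j (p + t • w) ≤ d j := by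
  refine eventually_all.2 fun j => ?_
  rcases (hp j).eq_or_lt with h | h
  · refine Eventually.of_forall fun t => ?_
    simp [mem_faceDirection.1 hw j h, h]
  · have : Continuous fun t : ℝ => φ j (p + t • w) := by fun_prop
    exact (this.continuousAt.eventually_lt_const (by simpa using h)).mono fun t ht => ht.le

/-- Along the face of the epigraph of `r` at `(x, r x)`, the derivative of the lifted function
`(y, α) ↦ q y + α` agrees with every regular subgradient at `x` of a function below `q + r` that
touches it at `x`. -/
theorem liftedLinear_eq_of_mem_regularSubdifferential {a : V →L[ℝ] V}
    (ha : ∀ x y, inner ℝ (a x) y = inner ℝ (a y) x) (b : V) (β : ℝ) {r u : V → EReal}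
    {k : ℕ} {φ : Fin k → (V × ℝ) →L[ℝ] ℝ} {d : Fin k → ℝ}
    (hr : epigraph r = {p | ∀ j, φ j p ≤ d j})
    (hu : ∀ y, u y ≤ (quadratic a b β y : EReal) + r y) {x : V} {ρ : ℝ} (hρ : r x = ρ)
    (hux : u x = ((quadratic a b β x + ρ : ℝ) : EReal)) {v : V}
    (hv : v ∈ regularSubdifferential u x) {w : V × ℝ}
    (hw : w ∈ faceDirection φ {j | φ j (x, ρ) = d j}) :
    liftedLinear (a x + b) w = inner ℝ v w.1 := by
  have hp : (x, ρ) ∈ epigraph r := hρ.le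
  rw [hr] at hp
  -- Both `w` and `-w` are feasible directions, so the one-sided subgradient inequality forces
  -- equality.
  refine sub_eq_zero.1 (linear_coeff_eq_zero (b := 1 / 2 * inner ℝ (a w.1) w.1)
    (norm_nonneg w.1) fun ε hε => ?_)
  have hlim : Tendsto (fun t : ℝ => x + t • w.1) (𝓝 0) (𝓝 x) := by
    have : Continuous fun t : ℝ => x + t • w.1 := by fun_prop
    simpa using this.tendsto 0
  filter_upwards [eventually_add_smul_mem_polyhedron hp hw, hlim.eventually (hv.2.2 ε hε)]
    with t h1 h2
  have h3 : (x, ρ) + t • w ∈ epigraph r := by rw [hr]; exact h1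
  have h4 : r (x + t • w.1) ≤ ((ρ + t * w.2 : ℝ) : EReal) := h3
  have h5 := h2.trans ((hu _).trans (add_le_add_right h4 _))
  rw [hux, ← EReal.coe_add, ← EReal.coe_add, EReal.coe_le_coe_iff, quadratic_add ha] at h5
  simp only [add_sub_cancel_left, map_smul, inner_smul_right, inner_smul_left, norm_smul,
    Real.norm_eq_abs, RCLike.conj_to_real] at h5
  rw [liftedLinear_apply]
  linarith

/-- The local bound behind the Kurdyka-Łojasiewicz inequality, for one piece `q + r` of a minimum
of quadratic plus polyhedral functions, at a fixed point `z` and level `c`. -/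
theorem exists_sub_le_sq_norm_regularSubgradient [FiniteDimensional ℝ V] {a : V →L[ℝ] V}
    (ha : ∀ x y, inner ℝ (a x) y = inner ℝ (a y) x) (b : V) (β : ℝ) {r u : V → EReal}
    (hr : IsPolyhedral r) (hu : ∀ y, u y ≤ (quadratic a b β y : EReal) + r y) (z : V) (c : ℝ) :
    ∃ C : ℝ, ∀ᶠ p in 𝓝 (z, c), ∀ ρ : ℝ, r p.1 = ρ → u p.1 = (p.2 : EReal) →
      p.2 = quadratic a b β p.1 + ρ → ∀ v ∈ regularSubdifferential u p.1,
        |p.2 - c| ≤ C * ‖v‖ ^ 2 := by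
  obtain ⟨k, φ, d, hφ⟩ := hr
  -- The face varies with `p`, so constants are taken for all active sets at once.
  choose C hC using fun J : Set (Fin k) =>
    exists_quadratic_le_sq_gradient_of_mem (liftedHessian a)
      (fun x y => by simp only [liftedHessian_apply, ha]) (liftedLinear (a z + b))
      (faceDirection φ J)
  obtain ⟨M, hM⟩ := (Set.finite_range C).bddAbove
  refine ⟨M, ?_⟩
  set P : V × ℝ → V × ℝ := fun p => (p.1, p.2 - quadratic a b β p.1) with hP
  have hPc : Continuous P := by
    have := continuous_quadratic a b β
    fun_prop
  -- Constraints active at `P p` are already active at `P (z, c)`, so the displacement between them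
  -- lies in the face direction at `P p`.
  have e1 : ∀ᶠ p in 𝓝 (z, c), ∀ j, φ j (P (z, c)) ≠ d j → φ j (P p) ≠ d j := by
    refine eventually_all.2 fun j => ?_
    by_cases h : φ j (P (z, c)) = d j
    · simp [h]
    · have : Continuous fun p => φ j (P p) := (φ j).continuous.comp hPc
      exact (this.continuousAt.eventually_ne h).mono fun p hp _ => hp
  have e2 : Tendsto (fun p => P p - P (z, c)) (𝓝 (z, c)) (𝓝 0) := by
    have : Continuous fun p => P p - P (z, c) := by fun_prop
    simpa using this.tendsto (z, c)
  filter_upwards [e1, e2.eventually (eventually_all.2 hC)] with p h1 h2 ρ hρ hup hpρ v hv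
  have hPp : P p = (p.1, ρ) := by simp [hP, hpρ]
  have hgrad : ∀ w ∈ faceDirection φ {j | φ j (P p) = d j},
      |liftedLinear (a z + b) w + liftedHessian a (P p - P (z, c)) w| ≤ ‖v‖ * ‖w‖ := by
    intro w hw
    rw [hPp] at hw
    have h3 := liftedLinear_eq_of_mem_regularSubdifferential ha b β hφ hu hρ
      (hup.trans (by rw [← hpρ])) hv hw
    have h4 : liftedLinear (a z + b) w + liftedHessian a (P p - P (z, c)) w = inner ℝ v w.1 := by
      rw [← h3]
      rw [liftedHessian_apply, Prod.fst_sub, map_sub]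
      simp only [liftedLinear_apply, hP, inner_add_left, inner_sub_left]
      ring
    rw [h4]
    exact (abs_real_inner_le_norm _ _).trans (by gcongr; exact norm_fst_le w)
  have hmem : P p - P (z, c) ∈ faceDirection φ {j | φ j (P p) = d j} := by
    refine mem_faceDirection.2 fun j hj => ?_
    have h3 : φ j (P (z, c)) = d j := by
      by_contra h
      exact h1 j h hj
    rw [map_sub, h3, hj, sub_self]
  have h5 := h2 _ hmem ‖v‖ (norm_nonneg v) hgrad
  -- The second-order expansion of the lifted quadratic is exact.
  have h6 : liftedLinear (a z + b) (P p - P (z, c)) +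
      1 / 2 * liftedHessian a (P p - P (z, c)) (P p - P (z, c)) = p.2 - c := by
    have h7 := quadratic_add ha b β z (p.1 - z)
    rw [add_sub_cancel] at h7
    simp only [liftedLinear_apply, liftedHessian_apply, hP, Prod.fst_sub, Prod.snd_sub]
    linarith
  rw [h6] at h5
  refine h5.trans ?_
  gcongr
  exact hM ⟨_, rfl⟩

/-! ### Limiting subgradients and finite minima -/

/-- An inequality between function values and norms passes from regular to limiting
subgradients. -/
theorem hasKLProperty_half_of_eventually {u : V → EReal} {z : V} {c C : ℝ} (hz : u z = c)
    (h : ∀ᶠ p : V × ℝ in 𝓝 (z, c), u p.1 = (p.2 : EReal) →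
      ∀ v ∈ regularSubdifferential u p.1, |p.2 - c| ≤ C * ‖v‖ ^ 2) :
    HasKLProperty u (1 / 2) z := by
  obtain ⟨δ, hδ, hball⟩ := Metric.eventually_nhds_iff_ball.1 h
  -- `max C 1` keeps the constant positive, as `C` may have any sign.
  refine ⟨by simp [hz], by simp [hz], Metric.ball z δ, Metric.ball_mem_nhds z hδ,
    (√(max C 1))⁻¹, δ, by positivity, hδ, ?_⟩
  rintro x hx hlo hhi g ⟨hbot, htop, xs, vs, hxs, hus, hvs, hg⟩
  refine klPow_half_le_of_le_sq (by positivity) (norm_nonneg g) ?_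
  refine le_trans ?_ (mul_le_mul_of_nonneg_right (le_max_left C 1) (sq_nonneg _))
  rw [hz, EReal.toReal_coe]
  have hur : Tendsto (fun k => (u (xs k)).toReal) atTop (𝓝 (u x).toReal) :=
    (EReal.tendsto_toReal htop hbot).comp hus
  refine le_of_tendsto_of_tendsto ((hur.sub_const c).abs) ((hg.norm.pow 2).const_mul C) ?_
  have hcoe : ((u x).toReal : EReal) = u x := EReal.coe_toReal htop hbot
  rw [hz, ← hcoe, ← EReal.coe_sub, EReal.coe_lt_coe_iff] at hlo
  rw [hz, ← hcoe, ← EReal.coe_add, EReal.coe_lt_coe_iff] at hhi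
  have hux : (u x).toReal ∈ Metric.ball c δ := by
    rw [Metric.mem_ball, Real.dist_eq, abs_lt]
    constructor <;> linarith
  filter_upwards [hxs.eventually (Metric.isOpen_ball.mem_nhds hx),
    hur.eventually (Metric.isOpen_ball.mem_nhds hux)] with k h1 h2
  refine hball (xs k, (u (xs k)).toReal) ?_
    (EReal.coe_toReal (hvs k).2.1 (hvs k).1).symm (vs k) (hvs k)
  rw [← ball_prod_same]
  exact ⟨h1, h2⟩

theorem lowerSemicontinuous_coe_add {X : Type*} [TopologicalSpace X] {q : X → ℝ} {r : X → EReal}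
    (hq : Continuous q) (hr : LowerSemicontinuous r) :
    LowerSemicontinuous fun x => (q x : EReal) + r x :=
  (continuous_coe_real_ereal.comp hq).lowerSemicontinuous.add' hr fun x =>
    EReal.continuousAt_add (by simp) (by simp)

theorem lowerSemicontinuous_iInf_of_finite {X ι : Type*} [TopologicalSpace X] [Finite ι]
    [Nonempty ι] {f : ι → X → EReal} (hf : ∀ i, LowerSemicontinuous (f i)) :
    LowerSemicontinuous fun x => ⨅ i, f i x := by
  intro x y hy
  filter_upwards [eventually_all.2 fun i => hf i x y (hy.trans_le (iInf_le _ i))] with x' h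
  obtain ⟨i, hi⟩ := exists_eq_ciInf_of_finite (f := fun i => f i x')
  exact (h i).trans_eq hi

/-- A finite minimum of quadratic plus polyhedral functions is a KL function with
exponent `1/2`. -/
theorem isKLFunction_iInf_quadratic_add_polyhedral [FiniteDimensional ℝ V] {ι : Type*} [Finite ι]
    [Nonempty ι] {a : ι → V →L[ℝ] V} (ha : ∀ i x y, inner ℝ (a i x) y = inner ℝ (a i y) x)
    (b : ι → V) (β : ι → ℝ) {r : ι → V → EReal} (hr : ∀ i, IsProperClosed (r i))
    (hpoly : ∀ i, IsPolyhedral (r i)) {u : V → EReal}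
    (hu : ∀ x, u x = ⨅ i, (quadratic (a i) (b i) (β i) x : EReal) + r i x) :
    IsKLFunction u (1 / 2) := by
  have hle : ∀ i x, u x ≤ (quadratic (a i) (b i) (β i) x : EReal) + r i x := fun i x =>
    (hu x).trans_le (iInf_le _ i)
  have hex : ∀ x, ∃ i, u x = (quadratic (a i) (b i) (β i) x : EReal) + r i x := fun x => by
    obtain ⟨i, hi⟩ := exists_eq_ciInf_of_finite
      (f := fun i => (quadratic (a i) (b i) (β i) x : EReal) + r i x)
    exact ⟨i, (hu x).trans hi.symm⟩
  refine ⟨⟨by norm_num, by norm_num⟩, ⟨⟨fun x hx => ?_, ?_⟩, ?_⟩, fun z ⟨g, hbot, htop, _⟩ => ?_⟩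
  · obtain ⟨i, hi⟩ := hex x
    rw [hi, EReal.add_eq_bot_iff] at hx
    exact hx.elim (EReal.coe_ne_bot _) ((hr i).1.1 x)
  · obtain ⟨i⟩ := ‹Nonempty ι›
    obtain ⟨x, hx⟩ := (hr i).1.2
    exact ⟨x, ((hle i x).trans_lt (EReal.add_lt_top (EReal.coe_ne_top _) hx)).ne⟩
  · rw [funext hu]
    exact lowerSemicontinuous_iInf_of_finite fun i =>
      lowerSemicontinuous_coe_add (continuous_quadratic _ _ _) (hr i).2
  · have hz : u z = ((u z).toReal : EReal) := (EReal.coe_toReal htop hbot).symm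
    choose C hC using fun i => exists_sub_le_sq_norm_regularSubgradient (ha i) (b i) (β i)
      (hpoly i) (hle i) z (u z).toReal
    obtain ⟨M, hM⟩ := (Set.finite_range C).bddAbove
    refine hasKLProperty_half_of_eventually (C := M) hz ?_
    filter_upwards [eventually_all.2 hC] with p hp hup v hv
    -- The piece attaining the minimum at `p.1` need not attain it at `z`; the bound holds for every
    -- piece at the level `u z`.
    obtain ⟨i, hi⟩ := hex p.1
    have hrbot := (hr i).1.1 p.1
    have hrtop : r i p.1 ≠ ⊤ := fun h => hv.2.1 (by rw [hi, h, EReal.coe_add_top])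
    have hri : r i p.1 = ((r i p.1).toReal : EReal) := (EReal.coe_toReal hrtop hrbot).symm
    refine (hp i _ hri hup ?_ v hv).trans ?_
    · rw [hup, hri, ← EReal.coe_add, EReal.coe_eq_coe_iff] at hi
      exact hi
    · gcongr
      exact hM ⟨i, rfl⟩

end QuadraticPolyhedral

end KL

theorem theorem4 (n m : ℕ) (hm : 0 < m)
    (A : Fin m → Matrix (Fin n) (Fin n) ℝ) (hA : ∀ i, (A i).IsSymm)
    (b : Fin m → EuclideanSpace ℝ (Fin n)) (β : Fin m → ℝ)
    (r : Fin m → EuclideanSpace ℝ (Fin n) → EReal)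
    (hr : ∀ i, KL.IsProperClosed (r i)) (hpoly : ∀ i, KL.IsPolyhedral (r i))
    (u : EuclideanSpace ℝ (Fin n) → EReal)
    (hu : ∀ x, u x = ⨅ i : Fin m,
      (((1 / 2 : ℝ) * (x.ofLp ⬝ᵥ (A i).mulVec x.ofLp) + (b i).ofLp ⬝ᵥ x.ofLp + β i : ℝ) : EReal)
        + r i x)
    (hcont : ContinuousOn u (KL.domSubdifferential u)) :
    KL.IsKLFunction u (1 / 2) := by
  have : Nonempty (Fin m) := ⟨⟨0, hm⟩⟩
  refine KL.isKLFunction_iInf_quadratic_add_polyhedral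
    (a := fun i => Matrix.toEuclideanCLM (𝕜 := ℝ) (A i)) (fun i x y => ?_) b β hr hpoly
    fun x => ?_
  · simp only [EuclideanSpace.inner_eq_star_dotProduct, Matrix.ofLp_toEuclideanCLM, star_trivial]
    rw [Matrix.dotProduct_mulVec, ← Matrix.mulVec_transpose, (hA i).eq, dotProduct_comm]
  · rw [hu x]
    refine iInf_congr fun i => ?_
    simp only [KL.quadratic, EuclideanSpace.inner_eq_star_dotProduct, Matrix.ofLp_toEuclideanCLM,
      star_trivial]
    rw [dotProduct_comm x.ofLp, dotProduct_comm x.ofLp]
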